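/- Let $p > 2$ be a prime, let $n \ge 4$, and let $a_{i,j,k} \in \mathbf{F}_p$ for $1 \le i,j,k \le n$. Let $$G = \Big\langle x_1, \dots, x_n : [[x_i,x_j],x_k] = 1 \text{ for all } i,j,k, \quad x_i^p = \prod_{j<k} [x_j,x_k]^{a_{i,j,k}} \text{ for all } i \Big\rangle,$$ and suppose that $G$ has order $p^{n+\binom n2}$ and that every automorphism $\beta$ of $G$ is central, that is, $g^{-1}\beta(g) \in Z(G)$ for all $g \in G$. Let $S(G)$ be the group of permutations of the set $G$, let $\rho(G) \le S(G)$ be the image of the right regular representation, and put $\mathrm{Hol}(G) = N_{S(G)}(\rho(G))$ and $T(G) = N_{S(G)}(\mathrm{Hol}(G))/\mathrm{Hol}(G)$. The groups $V = G/G'$ and $W = G'$ are abelian of exponent dividing $p$; regard them as $\mathbf{F}_p$-vector spaces, and let $\mathfrak{D}$ be the $\mathbf{F}_p$-vector space of symmetric bilinear maps $V \times V \to W$. Then $\mathfrak{D}$ has dimension $\binom n2\binom{n+1}2$, and $T(G)$ contains a non-abelian subgroup of order $$(p-1)\cdot p^{\binom n2 \binom{n+1}2}$$ that is isomorphic to the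 semidirect product $\mathfrak{D} \rtimes \mathbf{F}_p^*$, where $\mathbf{F}_p^*$ acts on $\mathfrak{D}$ by scalar multiplication. -/

import Mathlib

open scoped commutatorElement

/-! ### The holomorph, the multiple holomorph, and the group `T(G)` -/

/-- The image `ρ(G)` in the group of permutations of the set `G` of the right regular
representation `g ↦ (h ↦ h * g)`. -/
def rightRegular (G : Type*) [Group G] : Subgroup (Equiv.Perm G) :=
  (MulAction.toPermHom Gᵐᵒᵖ G).range

/-- The holomorph `Hol(G) = N_{S(G)}(ρ(G))`. -/
def Hol (G : Type*) [Group G] : Subgroup (Equiv.Perm G) :=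
  Subgroup.normalizer (rightRegular G : Set (Equiv.Perm G))

/-- The multiple holomorph `NHol(G) = N_{S(G)}(Hol(G))`. -/
def NHol (G : Type*) [Group G] : Subgroup (Equiv.Perm G) :=
  Subgroup.normalizer (Hol G : Set (Equiv.Perm G))

instance Hol.normal_subgroupOf (G : Type*) [Group G] : ((Hol G).subgroupOf (NHol G)).Normal :=
  Subgroup.normal_in_normalizer

/-- The group `T(G) = NHol(G) / Hol(G)`. -/
abbrev TGroup (G : Type*) [Group G] : Type _ := NHol G ⧸ (Hol G).subgroupOf (NHol G)

/-- An automorphism is central if it induces the identity on `G / Z(G)`. -/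
def IsCentralAut {G : Type*} [Group G] (β : MulAut G) : Prop :=
  ∀ g : G, g⁻¹ * β g ∈ Subgroup.center G

/-! ### The groups of the Caranti type -/

/-- The relators `[[x_i, x_j], x_k]` for all `i, j, k`, and
`x_i ^ p * (∏_{j < k} [x_j, x_k] ^ a_{i,j,k})⁻¹` for all `i`. -/
def carantiRels (p n : ℕ) (a : Fin n → Fin n → Fin n → ZMod p) : Set (FreeGroup (Fin n)) :=
  {r | ∃ i j k : Fin n, r = ⁅⁅FreeGroup.of i, FreeGroup.of j⁆, FreeGroup.of k⁆} ∪
  {r | ∃ i : Fin n, r = FreeGroup.of i ^ p *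
    (((List.finRange n ×ˢ List.finRange n).filter (fun jk => jk.1 < jk.2)).map
      (fun jk => ⁅FreeGroup.of jk.1, FreeGroup.of jk.2⁆ ^ (a i jk.1 jk.2).val)).prod⁻¹}

/-- The group `⟨x_1, …, x_n : [[x_i, x_j], x_k] = 1, x_i ^ p = ∏_{j < k} [x_j, x_k] ^ a_{i,j,k}⟩`. -/
abbrev CarantiGroup (p n : ℕ) (a : Fin n → Fin n → Fin n → ZMod p) : Type :=
  PresentedGroup (carantiRels p n a)

namespace CarantiGroup

variable {p n : ℕ} {a : Fin n → Fin n → Fin n → ZMod p}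

theorem commutator_of_mem_center (i j : Fin n) :
    ⁅(PresentedGroup.of i : CarantiGroup p n a), PresentedGroup.of j⁆ ∈
      Subgroup.center (CarantiGroup p n a) := by
  rw [Subgroup.mem_center_iff]
  intro g
  have h := PresentedGroup.generated_by (carantiRels p n a)
    (Subgroup.centralizer {⁅(PresentedGroup.of i : CarantiGroup p n a), PresentedGroup.of j⁆})
    (fun k => by
      rw [Subgroup.mem_centralizer_singleton_iff]
      have := PresentedGroup.one_of_mem (rels := carantiRels p n a)
        (x := ⁅⁅FreeGroup.of i, FreeGroup.of j⁆, FreeGroup.of k⁆) (Or.inl ⟨i, j, k, rfl⟩)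
      rw [map_commutatorElement, map_commutatorElement, commutatorElement_eq_one_iff_mul_comm]
        at this
      exact this.symm) g
  rw [Subgroup.mem_centralizer_singleton_iff] at h
  exact h

theorem commutator_mem_center (g h : CarantiGroup p n a) :
    ⁅g, h⁆ ∈ Subgroup.center (CarantiGroup p n a) := by
  let π := QuotientGroup.mk' (Subgroup.center (CarantiGroup p n a))
  have key : ∀ x y : CarantiGroup p n a,
      ⁅x, y⁆ ∈ Subgroup.center (CarantiGroup p n a) ↔ π x * π y = π y * π x := by
    intro x y
    rw [← commutatorElement_eq_one_iff_mul_comm, ← map_commutatorElement]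
    exact (QuotientGroup.eq_one_iff _).symm
  have h1 : ∀ (i : Fin n) (x : CarantiGroup p n a),
      π x * π (PresentedGroup.of i) = π (PresentedGroup.of i) * π x := by
    intro i x
    have := PresentedGroup.generated_by (carantiRels p n a)
      ((Subgroup.centralizer {π (PresentedGroup.of i)}).comap π)
      (fun k => by
        rw [Subgroup.mem_comap, Subgroup.mem_centralizer_singleton_iff]
        exact (key _ _).1 (commutator_of_mem_center k i)) x
    rwa [Subgroup.mem_comap, Subgroup.mem_centralizer_singleton_iff] at this
  rw [key]
  have := PresentedGroup.generated_by (carantiRels p n a)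
    ((Subgroup.centralizer {π g}).comap π)
    (fun k => by
      rw [Subgroup.mem_comap, Subgroup.mem_centralizer_singleton_iff]
      exact (h1 k g).symm) h
  rw [Subgroup.mem_comap, Subgroup.mem_centralizer_singleton_iff] at this
  exact this.symm

theorem commutator_le_center :
    commutator (CarantiGroup p n a) ≤ Subgroup.center (CarantiGroup p n a) := by
  rw [commutator_def, Subgroup.commutator_le]
  intro g _ h _
  exact commutator_mem_center g h

theorem abelianization_pow (v : Abelianization (CarantiGroup p n a)) : v ^ p = 1 := by
  obtain ⟨g, rfl⟩ := QuotientGroup.mk_surjective v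
  have := PresentedGroup.generated_by (carantiRels p n a)
    ((powMonoidHom p).comp (Abelianization.of (G := CarantiGroup p n a))).ker
    (fun i => by
      have h := PresentedGroup.one_of_mem (rels := carantiRels p n a) (Or.inr ⟨i, rfl⟩)
      have h2 := congrArg (Abelianization.of (G := CarantiGroup p n a)) h
      rw [map_mul, map_mul, map_inv, map_inv, map_pow, map_pow, map_list_prod, map_list_prod,
        List.map_map, List.map_map, map_one] at h2
      rw [MonoidHom.mem_ker, MonoidHom.comp_apply, powMonoidHom_apply]
      rw [List.prod_eq_one, inv_one, mul_one] at h2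
      · exact h2
      · intro x hx
        obtain ⟨jk, -, rfl⟩ := List.mem_map.1 hx
        simp only [Function.comp_apply, map_pow, map_commutatorElement]
        rw [commutatorElement_eq_one_iff_mul_comm.2 (mul_comm _ _), one_pow]) g
  exact this

theorem pow_mem_center (g : CarantiGroup p n a) :
    g ^ p ∈ Subgroup.center (CarantiGroup p n a) := by
  apply commutator_le_center
  rw [← Abelianization.ker_of, MonoidHom.mem_ker, map_pow]
  exact abelianization_pow _

theorem commutatorElement_pow (g h : CarantiGroup p n a) : ⁅g, h⁆ ^ p = 1 := by
  have key : ∀ m : ℕ, ⁅g ^ m, h⁆ = ⁅g, h⁆ ^ m := by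
    intro m
    induction m with
    | zero => simp
    | succ m ih =>
      have hc := Subgroup.mem_center_iff.1 (commutator_mem_center g h) (g ^ m)
      rw [pow_succ (⁅g, h⁆), ← ih]
      calc ⁅g ^ (m + 1), h⁆ = (g ^ m * ⁅g, h⁆) * (h * (g ^ m)⁻¹ * h⁻¹) := by
            rw [pow_succ, commutatorElement_def, commutatorElement_def]; group
        _ = ⁅g, h⁆ * ⁅g ^ m, h⁆ := by
            rw [hc, commutatorElement_def (g ^ m) h]; group
        _ = ⁅g ^ m, h⁆ * ⁅g, h⁆ :=
            (Subgroup.mem_center_iff.1 (commutator_mem_center g h) _).symm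
  rw [← key, commutatorElement_eq_one_iff_mul_comm]
  exact (Subgroup.mem_center_iff.1 (pow_mem_center g) h).symm

theorem pow_eq_one_of_mem_commutator {w : CarantiGroup p n a}
    (hw : w ∈ commutator (CarantiGroup p n a)) : w ^ p = 1 := by
  rw [commutator_eq_closure] at hw
  induction hw using Subgroup.closure_induction with
  | mem x hx =>
    obtain ⟨g, h, rfl⟩ := hx
    exact commutatorElement_pow g h
  | one => exact one_pow p
  | mul x y hx hy ihx ihy =>
    rw [← commutator_eq_closure] at hx
    have hc : Commute x y := (Subgroup.mem_center_iff.1 (commutator_le_center hx) y).symm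
    rw [hc.mul_pow, ihx, ihy, one_mul]
  | inv x hx ihx => rw [inv_pow, ihx, inv_one]

/-- `V = G / G'`, written additively. -/
abbrev V (p n : ℕ) (a : Fin n → Fin n → Fin n → ZMod p) : Type :=
  Additive (Abelianization (CarantiGroup p n a))

/-- The `𝔽_p`-vector space structure of `V`; its addition is the group operation of `G / G'`. -/
instance moduleV : Module (ZMod p) (V p n a) :=
  AddCommGroup.zmodModule (fun v => abelianization_pow (Additive.toMul v))

/-- `W = G'`, written additively. -/
def W (p n : ℕ) (a : Fin n → Fin n → Fin n → ZMod p) : Type :=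
  Additive (commutator (CarantiGroup p n a))

/-- The addition of `W` is the group operation of `G'`. -/
instance addCommGroupW : AddCommGroup (W p n a) :=
  { (inferInstance : AddGroup (Additive (commutator (CarantiGroup p n a)))) with
    add_comm := fun x y => Subtype.ext
      (Subgroup.mem_center_iff.1 (commutator_le_center (Additive.toMul y).2)
        (Additive.toMul x).1) }

/-- The `𝔽_p`-vector space structure of `W`. -/
instance moduleW : Module (ZMod p) (W p n a) :=
  AddCommGroup.zmodModule (fun w =>
    Subtype.ext (pow_eq_one_of_mem_commutator (Additive.toMul w).2))

end CarantiGroup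

/-! ### Symmetric bilinear maps and the natural action of the scalars -/

/-- The space of symmetric `R`-bilinear maps `M × M → N`. -/
def symmBilin (R M N : Type*) [CommRing R] [AddCommGroup M] [AddCommGroup N] [Module R M]
    [Module R N] : Submodule R (M →ₗ[R] M →ₗ[R] N) where
  carrier := {B | ∀ v w, B v w = B w v}
  add_mem' := fun {B C} hB hC v w => by
    simp only [LinearMap.add_apply]
    rw [hB v w, hC v w]
  zero_mem' := fun _ _ => rfl
  smul_mem' := fun c B hB v w => by
    simp only [LinearMap.smul_apply]
    rw [hB v w]

/-- The action of `Rˣ` on an `R`-module `D` by scalar multiplication `d ↦ u • d`, with `D` regarded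
as a multiplicative group. -/
def scalarAction (R D : Type*) [CommRing R] [AddCommGroup D] [Module R D] :
    Rˣ →* MulAut (Multiplicative D) where
  toFun u := AddEquiv.toMultiplicative (DistribMulAction.toAddEquiv D u)
  map_one' := by
    ext x
    exact congrArg Multiplicative.ofAdd (one_smul Rˣ (Multiplicative.toAdd x))
  map_mul' u v := by
    ext x
    exact congrArg Multiplicative.ofAdd (mul_smul u v (Multiplicative.toAdd x))

/-! The order of `G` is the largest that the relations allow, so the generators give a basis of `V`
and the commutators `[x_i, x_j]`, `i < j`, a basis of `W`; consequently `Z(G) = G'`. As all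
automorphisms are central, `Hol(G)` then consists exactly of the maps `x ↦ x L(x) h` with `L : V →
W` linear and `h ∈ G`.

Two families of permutations normalise this set. The shears `x ↦ x · ½B(x, x)`, with `B` symmetric,
turn right multiplication by `h` into `x ↦ x B(h, x) h'`, and `B(h, ·)` is again linear. The power
maps `x ↦ x ^ s` with `s` prime to `p` do the same up to a multiple of `[h, x]`, because `G` has
class at most two. Since `G` has exponent dividing `p²`, taking `s = u ^ p` makes the powers an
action of `𝔽_p^*` with `s ≡ u` mod `p`. Conjugation by a power map scales the shears, hence a
semidirect product.

It meets `Hol(G)` trivially: modulo `W` an element of `Hol(G)` is a translation, which forces `u =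
1`, and a quadratic map that is linear is zero when `p` is odd, which forces `B = 0`. -/

/-! ### The holomorph as automorphisms followed by right translations -/

theorem mem_rightRegular_iff {G : Type*} [Group G] {r : Equiv.Perm G} :
    r ∈ rightRegular G ↔ ∃ h : G, ∀ x, r x = x * h := by
  constructor
  · rintro ⟨h, rfl⟩
    exact ⟨h.unop, fun x => rfl⟩
  · rintro ⟨h, hr⟩
    exact ⟨MulOpposite.op h, Equiv.ext fun x => (hr x).symm⟩

/-- Conjugating a translation to a translation means `f (x * h) = f x * k` with `k` independent of
`x`, and `x = 1` identifies `k`. Equivalently, `x ↦ f x * (f 1)⁻¹` is an automorphism. -/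
theorem mem_Hol_iff {G : Type*} [Group G] {f : Equiv.Perm G} :
    f ∈ Hol G ↔ ∀ x h, f (x * h) = f x * (f 1)⁻¹ * f h := by
  rw [Hol, Subgroup.mem_normalizer_iff]
  simp only [mem_rightRegular_iff]
  constructor
  · intro H x h
    obtain ⟨k, hk⟩ := (H (Equiv.mulRight h)).1 ⟨h, fun _ => rfl⟩
    have key : ∀ y, f (y * h) = f y * k := fun y => by simpa using hk (f y)
    have h1 := key 1
    rw [one_mul] at h1
    rw [key, h1, mul_assoc, inv_mul_cancel_left]
  · refine fun H r => ⟨?_, ?_⟩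
    · rintro ⟨h, hr⟩
      refine ⟨(f 1)⁻¹ * f h, fun x => ?_⟩
      simp [hr, H, mul_assoc]
    · rintro ⟨k, hk⟩
      refine ⟨f⁻¹ (f 1 * k), fun x => f.injective ?_⟩
      rw [H]
      simpa [mul_assoc] using hk (f x)

/-! ### Commutator and power calculus in class two -/

namespace CarantiGroup

variable {p n : ℕ} {a : Fin n → Fin n → Fin n → ZMod p}

/-- The projection `G → V = G / G'`. -/
def toV (g : CarantiGroup p n a) : V p n a := Additive.ofMul (Abelianization.of g)

/-- The inclusion `W = G' → G`. -/
def ofW (w : W p n a) : CarantiGroup p n a :=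
  ((Additive.toMul (α := commutator (CarantiGroup p n a)) w : commutator (CarantiGroup p n a)) :
    CarantiGroup p n a)

theorem toV_one : toV (1 : CarantiGroup p n a) = 0 := rfl

theorem toV_mul (g h : CarantiGroup p n a) : toV (g * h) = toV g + toV h := rfl

theorem toV_pow (g : CarantiGroup p n a) (s : ℕ) : toV (g ^ s) = s • toV g := by
  simp [toV]

theorem toV_surjective : Function.Surjective (toV : CarantiGroup p n a → V p n a) := fun v =>
  QuotientGroup.mk_surjective (Additive.toMul v)

theorem toV_eq_zero_iff {g : CarantiGroup p n a} :
    toV g = 0 ↔ g ∈ commutator (CarantiGroup p n a) := by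
  rw [← Abelianization.ker_of, MonoidHom.mem_ker]
  rfl

theorem ofW_zero : ofW (0 : W p n a) = 1 := rfl

theorem ofW_add (v w : W p n a) : ofW (v + w) = ofW v * ofW w := rfl

theorem ofW_nsmul (s : ℕ) (w : W p n a) : ofW (s • w) = ofW w ^ s := by
  induction s with
  | zero => simp [ofW_zero]
  | succ s ih => rw [succ_nsmul, ofW_add, ih, pow_succ]

theorem ofW_injective : Function.Injective (ofW : W p n a → CarantiGroup p n a) :=
  fun _ _ h => Subtype.ext h

theorem toV_ofW (w : W p n a) : toV (ofW w) = 0 :=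
  toV_eq_zero_iff.2 (Additive.toMul (α := commutator (CarantiGroup p n a)) w).2

theorem exists_ofW {g : CarantiGroup p n a} (h : toV g = 0) : ∃ w, ofW w = g :=
  ⟨Additive.ofMul (⟨g, toV_eq_zero_iff.1 h⟩ : commutator (CarantiGroup p n a)), rfl⟩

theorem ofW_comm (w : W p n a) (g : CarantiGroup p n a) : ofW w * g = g * ofW w :=
  (Subgroup.mem_center_iff.1 (commutator_le_center
    (Additive.toMul (α := commutator (CarantiGroup p n a)) w).2) g).symm

/-- The commutator `⁅g, h⁆` as an element of `W`. -/
def commW (g h : CarantiGroup p n a) : W p n a :=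
  Additive.ofMul (⟨⁅g, h⁆, Subgroup.commutator_mem_commutator trivial trivial⟩ :
    commutator (CarantiGroup p n a))

theorem ofW_commW (g h : CarantiGroup p n a) : ofW (commW g h) = ⁅g, h⁆ := rfl

theorem commW_mul_left (g g' h : CarantiGroup p n a) :
    commW (g * g') h = commW g h + commW g' h := by
  apply ofW_injective
  have := ofW_comm (commW g' h) (h * g⁻¹ * h⁻¹)
  simp only [ofW_add, ofW_commW] at this ⊢
  calc ⁅g * g', h⁆ = g * (⁅g', h⁆ * (h * g⁻¹ * h⁻¹)) := by simp only [commutatorElement_def]; group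
    _ = ⁅g, h⁆ * ⁅g', h⁆ := by rw [this]; simp only [commutatorElement_def]; group

theorem commW_swap (g h : CarantiGroup p n a) : commW h g = -commW g h := by
  rw [eq_neg_iff_add_eq_zero]
  apply ofW_injective
  rw [ofW_add, ofW_commW, ofW_commW, ofW_zero, ← commutatorElement_inv, inv_mul_cancel]

theorem commW_mul_right (g h h' : CarantiGroup p n a) :
    commW g (h * h') = commW g h + commW g h' := by
  rw [commW_swap, commW_mul_left, neg_add, ← commW_swap, ← commW_swap]

theorem commW_self (g : CarantiGroup p n a) : commW g g = 0 :=
  ofW_injective (by rw [ofW_commW, commutatorElement_self, ofW_zero])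

/-- The bilinear map `V × V → W` induced by the commutator. -/
def commMap (p n : ℕ) (a : Fin n → Fin n → Fin n → ZMod p) :
    V p n a →ₗ[ZMod p] V p n a →ₗ[ZMod p] W p n a :=
  AddMonoidHom.toZModLinearMap p <|
    (AddMonoidHom.mk' (AddMonoidHom.toZModLinearMap p) (fun _ _ => rfl)).comp <|
    MonoidHom.toAdditiveLeft <| Abelianization.lift <|
      MonoidHom.mk' (M := CarantiGroup p n a)
        (G := Multiplicative (V p n a →+ W p n a))
        (fun g => Multiplicative.ofAdd <| MonoidHom.toAdditiveLeft <| Abelianization.lift <|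
          MonoidHom.mk' (M := CarantiGroup p n a) (G := Multiplicative (W p n a))
            (fun h => Multiplicative.ofAdd (commW g h)) (commW_mul_right g))
        (fun g g' => by
          apply Multiplicative.toAdd.injective
          refine DFunLike.ext _ _ fun v => ?_
          obtain ⟨h, rfl⟩ := toV_surjective v
          exact commW_mul_left g g' h)

theorem commMap_toV (g h : CarantiGroup p n a) :
    commMap p n a (toV g) (toV h) = commW g h := rfl

theorem ofW_commMap (g h : CarantiGroup p n a) :
    ofW (commMap p n a (toV g) (toV h)) = ⁅g, h⁆ := rfl

theorem commMap_self (v : V p n a) : commMap p n a v v = 0 := by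
  obtain ⟨g, rfl⟩ := toV_surjective v
  exact commW_self g

/-- Moving `g` to the left past `h ^ s` costs `s` copies of the central commutator `⁅h, g⁆`; these
costs add up to the binomial coefficient. -/
theorem mul_pow_eq (g h : CarantiGroup p n a) (s : ℕ) :
    (g * h) ^ s = g ^ s * h ^ s * ofW (s.choose 2 • commMap p n a (toV h) (toV g)) := by
  induction s with
  | zero => simp [ofW_zero]
  | succ s ih =>
    have h1 : h ^ s * g = g * h ^ s * ofW (s • commMap p n a (toV h) (toV g)) := by
      have : s • commMap p n a (toV h) (toV g) = commMap p n a (toV (h ^ s)) (toV g) := by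
        rw [toV_pow, map_nsmul, LinearMap.smul_apply]
      rw [this, ← ofW_comm, ofW_commMap, commutatorElement_def]
      group
    rw [pow_succ, ih, Nat.choose_succ_succ' s 1, Nat.choose_one_right, add_smul, ofW_add,
      mul_assoc, ofW_comm, pow_succ g, pow_succ h]
    calc g ^ s * h ^ s * (g * h * ofW (s.choose 2 • commMap p n a (toV h) (toV g)))
        = g ^ s * (h ^ s * g) * h * ofW (s.choose 2 • commMap p n a (toV h) (toV g)) := by group
      _ = g ^ s * g * h ^ s * (ofW (s • commMap p n a (toV h) (toV g)) * h) *
          ofW (s.choose 2 • commMap p n a (toV h) (toV g)) := by rw [h1]; group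
      _ = _ := by rw [ofW_comm]; group

theorem mul_ofW_pow (g : CarantiGroup p n a) (w : W p n a) (s : ℕ) :
    (g * ofW w) ^ s = g ^ s * ofW (s • w) := by
  rw [(show Commute g (ofW w) from (ofW_comm w g).symm).mul_pow, ofW_nsmul]

theorem pow_p_sq (g : CarantiGroup p n a) : g ^ p ^ 2 = 1 := by
  rw [sq, pow_mul]
  apply pow_eq_one_of_mem_commutator
  rw [← toV_eq_zero_iff, toV_pow, ← Nat.cast_smul_eq_nsmul (ZMod p), ZMod.natCast_self, zero_smul]

/-! ### Bases of `V` and `W` -/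

theorem span_toV_of : Submodule.span (ZMod p)
    (Set.range fun i : Fin n => toV (PresentedGroup.of i : CarantiGroup p n a)) = ⊤ := by
  rw [eq_top_iff]
  rintro v -
  obtain ⟨g, rfl⟩ := toV_surjective v
  let S := (Submodule.span (ZMod p)
    (Set.range fun i : Fin n => toV (PresentedGroup.of i : CarantiGroup p n a))).toAddSubgroup
  exact PresentedGroup.generated_by (carantiRels p n a)
    (S.toSubgroup'.comap Abelianization.of) (fun i => Submodule.subset_span ⟨i, rfl⟩) g

/-- `G'` is generated by commutators, which are values of the bilinear map `commMap`, so bilinearity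
and antisymmetry reduce to pairs of generators with `i < j`. -/
theorem span_commMap : Submodule.span (ZMod p)
    (Set.range fun i : {ij : Fin n × Fin n // ij.1 < ij.2} =>
      commW (PresentedGroup.of i.1.1 : CarantiGroup p n a) (PresentedGroup.of i.1.2)) = ⊤ := by
  set S := Submodule.span (ZMod p)
    (Set.range fun i : {ij : Fin n × Fin n // ij.1 < ij.2} =>
      commW (PresentedGroup.of i.1.1 : CarantiGroup p n a) (PresentedGroup.of i.1.2)) with hS
  have h0 : ∀ i j, commW (PresentedGroup.of i : CarantiGroup p n a) (PresentedGroup.of j) ∈ S := by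
    intro i j
    rcases lt_trichotomy i j with h | rfl | h
    · exact Submodule.subset_span ⟨⟨(i, j), h⟩, rfl⟩
    · rw [commW_self]; exact S.zero_mem
    · rw [commW_swap]
      exact S.neg_mem (Submodule.subset_span ⟨⟨(j, i), h⟩, rfl⟩)
  have h1 : ∀ u v : V p n a, commMap p n a u v ∈ S := by
    intro u v
    have hu : u ∈ Submodule.span (ZMod p) (Set.range fun i : Fin n =>
      toV (PresentedGroup.of i : CarantiGroup p n a)) := by rw [span_toV_of]; trivial
    have hv : v ∈ Submodule.span (ZMod p) (Set.range fun i : Fin n =>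
      toV (PresentedGroup.of i : CarantiGroup p n a)) := by rw [span_toV_of]; trivial
    have h2 : ∀ j, u ∈ S.comap
        ((commMap p n a).flip (toV (PresentedGroup.of j : CarantiGroup p n a))) := by
      intro j
      refine Submodule.span_le.2 ?_ hu
      rintro _ ⟨i, rfl⟩
      exact h0 i j
    have h3 : v ∈ S.comap (commMap p n a u) := by
      refine Submodule.span_le.2 ?_ hv
      rintro _ ⟨j, rfl⟩
      exact h2 j
    exact h3
  rw [eq_top_iff]
  rintro w -
  have key : ∀ g : CarantiGroup p n a, g ∈ commutator (CarantiGroup p n a) →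
      ∃ w ∈ S, ofW w = g := by
    intro g hg
    rw [commutator_eq_closure] at hg
    induction hg using Subgroup.closure_induction with
    | mem x hx =>
      obtain ⟨g, h, rfl⟩ := hx
      exact ⟨_, h1 (toV g) (toV h), rfl⟩
    | one => exact ⟨0, S.zero_mem, rfl⟩
    | mul x y _ _ hx hy =>
      obtain ⟨v, hv, rfl⟩ := hx
      obtain ⟨w, hw, rfl⟩ := hy
      exact ⟨v + w, S.add_mem hv hw, rfl⟩
    | inv x _ hx =>
      obtain ⟨v, hv, rfl⟩ := hx
      exact ⟨-v, S.neg_mem hv, rfl⟩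
  obtain ⟨w', hw', h⟩ := key _ (toV_eq_zero_iff.1 (toV_ofW w))
  rwa [← ofW_injective h]

end CarantiGroup

/-! ### Dimension counts, and the centre -/

theorem card_lt_pairs (n : ℕ) :
    Fintype.card {ij : Fin n × Fin n // ij.1 < ij.2} = n.choose 2 := by
  rw [Fintype.card_subtype, Finset.card_filter, Fintype.sum_prod_type_right]
  simp only [← Finset.card_filter, Finset.filter_gt_eq_Iio, Fin.card_Iio]
  rw [Fin.sum_univ_eq_sum_range (fun i => i), Finset.sum_range_id, Nat.choose_two_right]

/-- A symmetric bilinear map is an arbitrary function on unordered pairs of basis vectors,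
repetitions allowed. -/
theorem finrank_symmBilin (p : ℕ) [Fact p.Prime] {M N : Type*} [AddCommGroup M] [AddCommGroup N]
    [Module (ZMod p) M] [Module (ZMod p) N] [Module.Finite (ZMod p) N] {n : ℕ}
    (b : Module.Basis (Fin n) (ZMod p) M) :
    Module.finrank (ZMod p) (symmBilin (ZMod p) M N) =
      Module.finrank (ZMod p) N * (n + 1).choose 2 := by
  let e : symmBilin (ZMod p) M N ≃ₗ[ZMod p] (Sym2 (Fin n) → N) :=
    { toFun := fun B => Sym2.lift ⟨fun i j => B.1 (b i) (b j), fun i j => B.2 _ _⟩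
      map_add' := fun B C => by
        ext z
        induction z with | _ i j => rfl
      map_smul' := fun c B => by
        ext z
        induction z with | _ i j => rfl
      invFun := fun f => ⟨b.constr (ZMod p) fun i => b.constr (ZMod p) fun j => f s(i, j), by
        intro v w
        let C := b.constr (ZMod p) fun i => b.constr (ZMod p) fun j => f s(i, j)
        have : C = C.flip := by
          refine b.ext fun i => b.ext fun j => ?_
          simp [C, Sym2.eq_swap]
        exact LinearMap.congr_fun₂ this v w⟩
      left_inv := fun B => by
        apply Subtype.ext
        refine b.ext fun i => b.ext fun j => ?_
        simp
      right_inv := fun f => by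
        ext z
        induction z with | _ i j => simp }
  rw [e.finrank_eq, Module.finrank_pi_fintype, Finset.sum_const, Finset.card_univ, Sym2.card,
    Fintype.card_fin, smul_eq_mul, mul_comm]

namespace CarantiGroup

variable {p n : ℕ} {a : Fin n → Fin n → Fin n → ZMod p}

instance finiteV : Module.Finite (ZMod p) (V p n a) :=
  .of_fg_top (span_toV_of ▸ Submodule.fg_span (Set.finite_range _))

instance finiteW : Module.Finite (ZMod p) (W p n a) :=
  .of_fg_top (span_commMap ▸ Submodule.fg_span (Set.finite_range _))

variable [Fact p.Prime]

theorem finrank_V_le : Module.finrank (ZMod p) (V p n a) ≤ n := by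
  have := finrank_range_le_card (R := ZMod p)
    (fun i : Fin n => toV (PresentedGroup.of i : CarantiGroup p n a))
  rwa [Set.finrank, span_toV_of, finrank_top, Fintype.card_fin] at this

theorem finrank_W_le : Module.finrank (ZMod p) (W p n a) ≤ n.choose 2 := by
  have := finrank_range_le_card (R := ZMod p)
    (fun i : {ij : Fin n × Fin n // ij.1 < ij.2} =>
      commW (PresentedGroup.of i.1.1 : CarantiGroup p n a) (PresentedGroup.of i.1.2))
  rwa [Set.finrank, span_commMap, finrank_top, card_lt_pairs] at this

theorem natCard_eq : Nat.card (CarantiGroup p n a) =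
    p ^ (Module.finrank (ZMod p) (V p n a) + Module.finrank (ZMod p) (W p n a)) := by
  rw [Subgroup.card_eq_card_quotient_mul_card_subgroup (commutator (CarantiGroup p n a)), pow_add]
  have h1 := Module.natCard_eq_pow_finrank (K := ZMod p) (V := V p n a)
  have h2 := Module.natCard_eq_pow_finrank (K := ZMod p) (V := W p n a)
  rw [Nat.card_zmod] at h1 h2
  rw [← h1, ← h2]
  rfl

/-- The spanning sets bound both dimensions from above, and the order of `G` forces the sum of the
two bounds to be attained. -/
theorem finrank_eq (hcard : Nat.card (CarantiGroup p n a) = p ^ (n + n.choose 2)) :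
    Module.finrank (ZMod p) (V p n a) = n ∧
      Module.finrank (ZMod p) (W p n a) = n.choose 2 := by
  rw [natCard_eq] at hcard
  have := Nat.pow_right_injective (Fact.out : p.Prime).two_le hcard
  have h1 := finrank_V_le (a := a)
  have h2 := finrank_W_le (a := a)
  omega

/-- The basis of `V` given by the generators. -/
noncomputable def basisV (hcard : Nat.card (CarantiGroup p n a) = p ^ (n + n.choose 2)) :
    Module.Basis (Fin n) (ZMod p) (V p n a) :=
  basisOfTopLeSpanOfCardEqFinrank
    (fun i => toV (PresentedGroup.of i : CarantiGroup p n a)) span_toV_of.ge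
    (by rw [(finrank_eq hcard).1, Fintype.card_fin])

theorem linearIndependent_commW (hcard : Nat.card (CarantiGroup p n a) = p ^ (n + n.choose 2)) :
    LinearIndependent (ZMod p) (fun i : {ij : Fin n × Fin n // ij.1 < ij.2} =>
      commW (PresentedGroup.of i.1.1 : CarantiGroup p n a) (PresentedGroup.of i.1.2)) :=
  linearIndependent_of_top_le_span_of_card_eq_finrank span_commMap.ge
    (by rw [(finrank_eq hcard).2, card_lt_pairs])

theorem linearIndependent_commW_left
    (hcard : Nat.card (CarantiGroup p n a) = p ^ (n + n.choose 2)) (j : Fin n) :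
    LinearIndependent (ZMod p) (fun i : {i : Fin n // i ≠ j} =>
      commW (PresentedGroup.of i.1 : CarantiGroup p n a) (PresentedGroup.of j)) := by
  have h := (linearIndependent_commW hcard).comp
    (fun i : {i : Fin n // i ≠ j} => if h : i.1 < j then
      (⟨(i.1, j), h⟩ : {ij : Fin n × Fin n // ij.1 < ij.2}) else
      ⟨(j, i.1), lt_of_le_of_ne (not_lt.1 h) i.2.symm⟩) (by
      rintro ⟨i, hi⟩ ⟨k, hk⟩ h
      by_cases h1 : i < j <;> by_cases h2 : k < j <;> simp [h1, h2] at h ⊢ <;> grind)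
  -- The signs account for `[x_i, x_j] = -[x_j, x_i]` when `i > j`.
  have h' := h.units_smul (fun i => if i.1 < j then 1 else -1)
  convert h' using 1
  ext1 i
  by_cases hi : i.1 < j
  · simp [hi]
  · simp only [Pi.smul_apply', Function.comp_apply, hi, if_false, dif_neg, not_false_iff]
    rw [commW_swap, Units.smul_def, Units.val_neg, Units.val_one, neg_one_smul]

theorem center_eq_commutator (hn : 2 ≤ n)
    (hcard : Nat.card (CarantiGroup p n a) = p ^ (n + n.choose 2)) :
    Subgroup.center (CarantiGroup p n a) = commutator (CarantiGroup p n a) := by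
  refine le_antisymm (fun g hg => ?_) commutator_le_center
  rw [← toV_eq_zero_iff]
  set b := basisV hcard with hb
  have hbi : ∀ i, b i = toV (PresentedGroup.of i : CarantiGroup p n a) := fun i => by
    rw [hb, basisV, coe_basisOfTopLeSpanOfCardEqFinrank]
  have hcoord : ∀ i, b.repr (toV g) i = 0 := by
    intro i
    have : Nontrivial (Fin n) := Fin.nontrivial_iff_two_le.2 hn
    obtain ⟨j, hj⟩ := exists_ne i
    -- Pairing a central `g` with a generator `x_j`, `j ≠ i`, gives a relation among the independent
    -- `[x_k, x_j]`, `k ≠ j`, in which the `i`-th coordinate of `g` occurs.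
    have h1 : commMap p n a (toV g) (b j) = 0 := by
      rw [hbi]
      apply ofW_injective
      rw [ofW_commMap, ofW_zero, commutatorElement_eq_one_iff_mul_comm]
      exact (Subgroup.mem_center_iff.1 hg _).symm
    rw [← b.sum_repr (toV g), map_sum, LinearMap.sum_apply] at h1
    have h2 : ∑ i : {i : Fin n // i ≠ j}, b.repr (toV g) i •
        commW (PresentedGroup.of i.1 : CarantiGroup p n a) (PresentedGroup.of j) = 0 := by
      rw [← h1, ← Fintype.sum_subtype_add_sum_subtype (fun i => i ≠ j), Finset.sum_eq_zero
        (s := (Finset.univ : Finset {i : Fin n // ¬ i ≠ j})), add_zero]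
      · refine Finset.sum_congr rfl fun i _ => ?_
        rw [map_smul, LinearMap.smul_apply, hbi, hbi, commMap_toV]
      · rintro ⟨i, hi⟩ -
        obtain rfl := not_not.1 hi
        rw [map_smul, LinearMap.smul_apply, commMap_self, smul_zero]
    exact Fintype.linearIndependent_iff.1 (linearIndependent_commW_left hcard j) _ h2 ⟨i, hj.symm⟩
  rw [← b.sum_repr (toV g)]
  exact Finset.sum_eq_zero fun i _ => by rw [hcoord, zero_smul]

end CarantiGroup

/-! ### Two general facts: normalising a subgroup, and congruences of `p`-th powers -/

/-- A single inclusion suffices, since applying it to `x⁻¹` gives the reverse one. -/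
theorem range_le_NHol {G A : Type*} [Group G] [Group A] (φ : A →* Equiv.Perm G)
    (h : ∀ x, ∀ f ∈ Hol G, φ x * f * (φ x)⁻¹ ∈ Hol G) : φ.range ≤ NHol G := by
  rintro _ ⟨x, rfl⟩
  refine Subgroup.mem_normalizer_iff.2 fun f => ⟨h x f, fun hf => ?_⟩
  have := h x⁻¹ _ hf
  rw [map_inv] at this
  convert this using 1
  group

theorem Nat.ModEq.pow_prime {p x y : ℕ} (h : x ≡ y [MOD p]) : x ^ p ≡ y ^ p [MOD p ^ 2] := by
  rw [Nat.modEq_iff_dvd] at h ⊢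
  have := dvd_sub_pow_of_dvd_sub h 1
  push_cast
  simpa using this

/-! ### The normal form `x ↦ x L(x) h` of the holomorph -/

namespace CarantiGroup

variable {p n : ℕ} {a : Fin n → Fin n → Fin n → ZMod p}

theorem exists_linearMap (φ : CarantiGroup p n a → W p n a) (h : ∀ x y, φ (x * y) = φ x + φ y) :
    ∃ L : V p n a →ₗ[ZMod p] W p n a, ∀ x, L (toV x) = φ x :=
  ⟨AddMonoidHom.toZModLinearMap p <| MonoidHom.toAdditiveLeft <| Abelianization.lift <|
    MonoidHom.mk' (G := Multiplicative (W p n a)) (fun x => Multiplicative.ofAdd (φ x)) h,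
    fun _ => rfl⟩

theorem mem_Hol_of_forall_eq {f : Equiv.Perm (CarantiGroup p n a)}
    {L : V p n a →ₗ[ZMod p] W p n a} {h : CarantiGroup p n a}
    (hf : ∀ x, f x = x * ofW (L (toV x)) * h) : f ∈ Hol (CarantiGroup p n a) := by
  refine mem_Hol_iff.2 fun x y => ?_
  simp only [hf, toV_mul, map_add, ofW_add, toV_one, map_zero, ofW_zero, one_mul]
  rw [mul_assoc x, ← mul_assoc y, ← ofW_comm _ y]
  group

/-- For the automorphism `β x = f x * (f 1)⁻¹`, the element `x⁻¹ * β x` lies in `Z(G) = G'`; being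
central, it depends multiplicatively on `x` and so defines `L`. -/
theorem exists_forall_eq_of_mem_Hol
    (hZ : Subgroup.center (CarantiGroup p n a) = commutator (CarantiGroup p n a))
    (hcentral : ∀ β : MulAut (CarantiGroup p n a), IsCentralAut β)
    {f : Equiv.Perm (CarantiGroup p n a)} (hf : f ∈ Hol (CarantiGroup p n a)) :
    ∃ (L : V p n a →ₗ[ZMod p] W p n a) (h : CarantiGroup p n a),
      ∀ x, f x = x * ofW (L (toV x)) * h := by
  let β : MulAut (CarantiGroup p n a) := MulEquiv.mk' (f.trans (Equiv.mulRight (f 1)⁻¹))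
    fun x y => by simp [mem_Hol_iff.1 hf x y, mul_assoc]
  have hβ : ∀ x, ∃ w : W p n a, ofW w = x⁻¹ * β x := fun x =>
    exists_ofW (toV_eq_zero_iff.2 (hZ ▸ hcentral β x))
  choose φ hφ using hβ
  obtain ⟨L, hL⟩ := exists_linearMap φ fun x y => by
    apply ofW_injective
    have := ofW_comm (φ x) y⁻¹
    rw [hφ] at this
    rw [ofW_add, hφ, hφ, hφ, map_mul, mul_inv_rev]
    calc y⁻¹ * x⁻¹ * (β x * β y) = y⁻¹ * (x⁻¹ * β x) * β y := by group
      _ = x⁻¹ * β x * (y⁻¹ * β y) := by rw [← this]; group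
  refine ⟨L, f 1, fun x => ?_⟩
  rw [hL, hφ, mul_inv_cancel_left]
  exact (inv_mul_cancel_right (f x) (f 1)).symm

/-- The condition `hθ` says that `θ` carries each normal form to another one, written as `θ ∘ f = f'
∘ θ` so that `θ⁻¹` need not be computed. -/
theorem conj_mem_Hol
    (hZ : Subgroup.center (CarantiGroup p n a) = commutator (CarantiGroup p n a))
    (hcentral : ∀ β : MulAut (CarantiGroup p n a), IsCentralAut β)
    {θ : Equiv.Perm (CarantiGroup p n a)}
    (hθ : ∀ (L : V p n a →ₗ[ZMod p] W p n a) (h : CarantiGroup p n a),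
      ∃ (L' : V p n a →ₗ[ZMod p] W p n a) (h' : CarantiGroup p n a),
        ∀ x, θ (x * ofW (L (toV x)) * h) = θ x * ofW (L' (toV (θ x))) * h')
    {f : Equiv.Perm (CarantiGroup p n a)} (hf : f ∈ Hol (CarantiGroup p n a)) :
    θ * f * θ⁻¹ ∈ Hol (CarantiGroup p n a) := by
  obtain ⟨L, h, hL⟩ := exists_forall_eq_of_mem_Hol hZ hcentral hf
  obtain ⟨L', h', hL'⟩ := hθ L h
  refine mem_Hol_of_forall_eq (L := L') (h := h') fun y => ?_
  rw [Equiv.Perm.mul_apply, Equiv.Perm.mul_apply, hL, hL', ← Equiv.Perm.mul_apply,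
    mul_inv_cancel, Equiv.Perm.one_apply]

/-- The action of `𝔇` on `G` by the permutations `g ↦ g * ½ B(g, g)`. -/
def shear (p n : ℕ) (a : Fin n → Fin n → Fin n → ZMod p) :
    Multiplicative (symmBilin (ZMod p) (V p n a) (W p n a)) →*
      Equiv.Perm (CarantiGroup p n a) :=
  MonoidHom.toHomPerm
    { toFun := fun (B : Multiplicative (symmBilin (ZMod p) (V p n a) (W p n a))) g =>
        g * ofW ((2 : ZMod p)⁻¹ • (Multiplicative.toAdd B).1 (toV g) (toV g))
      map_one' := by
        funext g
        change g * ofW ((2 : ZMod p)⁻¹ • (0 : W p n a)) = g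
        rw [smul_zero, ofW_zero, mul_one]
      map_mul' := fun B C => by
        funext g
        change g * ofW ((2 : ZMod p)⁻¹ • ((Multiplicative.toAdd B).1 (toV g) (toV g) +
          (Multiplicative.toAdd C).1 (toV g) (toV g))) = g * ofW _ * ofW ((2 : ZMod p)⁻¹ •
            (Multiplicative.toAdd B).1 (toV (g * ofW _)) (toV (g * ofW _)))
        rw [toV_mul, toV_ofW, add_zero, smul_add, add_comm, ofW_add, mul_assoc] }

theorem shear_apply (B : Multiplicative (symmBilin (ZMod p) (V p n a) (W p n a)))
    (g : CarantiGroup p n a) :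
    shear p n a B g =
      g * ofW ((2 : ZMod p)⁻¹ • (Multiplicative.toAdd B).1 (toV g) (toV g)) := rfl

theorem toV_shear (B : Multiplicative (symmBilin (ZMod p) (V p n a) (W p n a)))
    (g : CarantiGroup p n a) : toV (shear p n a B g) = toV g := by
  rw [shear_apply, toV_mul, toV_ofW, add_zero]

/-! ### Shears and power maps normalise the holomorph -/

variable [Fact p.Prime]

/-- Polarisation: by symmetry of `B`, the quadratic map `½B(v, v)` fails to be additive by exactly
`B`. -/
theorem shear_mul (h2 : (2 : ZMod p) ≠ 0)
    (B : Multiplicative (symmBilin (ZMod p) (V p n a) (W p n a))) (g h : CarantiGroup p n a) :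
    shear p n a B (g * h) = shear p n a B g *
      ofW ((Multiplicative.toAdd B).1 (toV h) (toV g)) * shear p n a B h := by
  have : (2 : ZMod p)⁻¹ • (Multiplicative.toAdd B).1 (toV g + toV h) (toV g + toV h) =
      (2 : ZMod p)⁻¹ • (Multiplicative.toAdd B).1 (toV g) (toV g) +
        (Multiplicative.toAdd B).1 (toV h) (toV g) +
        (2 : ZMod p)⁻¹ • (Multiplicative.toAdd B).1 (toV h) (toV h) := by
    simp only [map_add, LinearMap.add_apply]
    rw [(Multiplicative.toAdd B).2 (toV g) (toV h)]
    match_scalars <;> field_simp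
    ring
  rw [shear_apply, shear_apply, shear_apply, toV_mul, this, ofW_add, ofW_add]
  simp only [mul_assoc]
  rw [← mul_assoc (ofW _) h, ← mul_assoc (ofW _) (ofW _), ← ofW_add, ← mul_assoc h,
    ← ofW_comm _ h, ofW_add]
  simp only [mul_assoc]

theorem shear_conj (h2 : (2 : ZMod p) ≠ 0)
    (B : Multiplicative (symmBilin (ZMod p) (V p n a) (W p n a)))
    (L : V p n a →ₗ[ZMod p] W p n a) (h : CarantiGroup p n a) :
    ∃ (L' : V p n a →ₗ[ZMod p] W p n a) (h' : CarantiGroup p n a),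
      ∀ x, shear p n a B (x * ofW (L (toV x)) * h) =
        shear p n a B x * ofW (L' (toV (shear p n a B x))) * h' := by
  refine ⟨L + (Multiplicative.toAdd B).1 (toV h), shear p n a B h, fun x => ?_⟩
  rw [shear_mul h2, shear_apply _ (x * _), toV_shear, toV_mul, toV_ofW, add_zero, shear_apply _ x,
    LinearMap.add_apply, ofW_add, mul_assoc x, ofW_comm _ (ofW _)]
  simp only [mul_assoc]

/-- The action of the scalars on `G` by the power maps `g ↦ g ^ (u ^ p)`. -/
def powPerm (p n : ℕ) [Fact p.Prime] (a : Fin n → Fin n → Fin n → ZMod p) :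
    (ZMod p)ˣ →* Equiv.Perm (CarantiGroup p n a) :=
  MonoidHom.toHomPerm
    { toFun := fun u g => g ^ ((u : ZMod p).val ^ p)
      map_one' := by
        funext g
        have : Fact (1 < p) := ⟨(Fact.out : p.Prime).one_lt⟩
        change g ^ (1 : ZMod p).val ^ p = g
        rw [ZMod.val_one, one_pow, pow_one]
      map_mul' := fun u v => by
        funext g
        -- Representatives multiply only modulo `p`; their `p`-th powers multiply modulo `p²`, which
        -- is enough because `g ^ p ^ 2 = 1`.
        have h : ((u * v : (ZMod p)ˣ) : ZMod p).val ≡ (v : ZMod p).val * (u : ZMod p).val [MOD p] := by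
          rw [← ZMod.natCast_eq_natCast_iff]
          simp [mul_comm]
        change g ^ ((u * v : (ZMod p)ˣ) : ZMod p).val ^ p =
          (g ^ (v : ZMod p).val ^ p) ^ (u : ZMod p).val ^ p
        rw [← pow_mul, ← mul_pow, pow_eq_pow_iff_modEq]
        exact h.pow_prime.of_dvd (orderOf_dvd_of_pow_eq_one (pow_p_sq g)) }

theorem powPerm_apply (u : (ZMod p)ˣ) (g : CarantiGroup p n a) :
    powPerm p n a u g = g ^ ((u : ZMod p).val ^ p) := rfl

theorem natCast_val_pow (u : ZMod p) : ((u.val ^ p : ℕ) : ZMod p) = u := by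
  rw [Nat.cast_pow, ZMod.natCast_zmod_val, ZMod.pow_card]

theorem val_pow_smul {M : Type*} [AddCommGroup M] [Module (ZMod p) M] (u : ZMod p) (m : M) :
    (u.val ^ p) • m = u • m := by
  rw [← Nat.cast_smul_eq_nsmul (ZMod p), natCast_val_pow]

theorem toV_powPerm (u : (ZMod p)ˣ) (g : CarantiGroup p n a) :
    toV (powPerm p n a u g) = (u : ZMod p) • toV g := by
  rw [powPerm_apply, toV_pow, val_pow_smul]

theorem powPerm_mul_ofW (u : (ZMod p)ˣ) (g : CarantiGroup p n a) (w : W p n a) :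
    powPerm p n a u (g * ofW w) = powPerm p n a u g * ofW ((u : ZMod p) • w) := by
  rw [powPerm_apply, powPerm_apply, mul_ofW_pow, val_pow_smul]

theorem powPerm_conj (u : (ZMod p)ˣ) (L : V p n a →ₗ[ZMod p] W p n a) (h : CarantiGroup p n a) :
    ∃ (L' : V p n a →ₗ[ZMod p] W p n a) (h' : CarantiGroup p n a),
      ∀ x, powPerm p n a u (x * ofW (L (toV x)) * h) =
        powPerm p n a u x * ofW (L' (toV (powPerm p n a u x))) * h' := by
  let c : ZMod p := (((u : ZMod p).val ^ p).choose 2 : ℕ)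
  -- Expanding the power of `x * h` produces `c • [h, x]`. The factor `u⁻¹` is there because `L'` is
  -- evaluated at `u • toV x`; for the same reason `L` itself is unchanged.
  refine ⟨L + (c * (u⁻¹ : (ZMod p)ˣ)) • commMap p n a (toV h), powPerm p n a u h, fun x => ?_⟩
  rw [mul_assoc x, ofW_comm, ← mul_assoc, powPerm_mul_ofW, toV_powPerm, powPerm_apply u (x * h),
    mul_pow_eq, ← powPerm_apply, ← powPerm_apply, map_smul, LinearMap.add_apply, smul_add, ofW_add,
    LinearMap.smul_apply, smul_smul,
    show (u : ZMod p) * (c * (u⁻¹ : (ZMod p)ˣ)) = c by rw [mul_left_comm, Units.mul_inv, mul_one],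
    Nat.cast_smul_eq_nsmul]
  rw [← ofW_add, mul_assoc _ (ofW _) (powPerm p n a u h), ofW_comm, add_comm, ofW_add]
  simp only [mul_assoc]

/-- The action of `𝔇 ⋊ 𝔽_p^*` on `G`. -/
def semidirectPerm (p n : ℕ) [Fact p.Prime] (a : Fin n → Fin n → Fin n → ZMod p) :
    Multiplicative (symmBilin (ZMod p) (V p n a) (W p n a))
      ⋊[scalarAction (ZMod p) (symmBilin (ZMod p) (V p n a) (W p n a))] (ZMod p)ˣ →*
      Equiv.Perm (CarantiGroup p n a) :=
  -- Conjugation by the power map of `s` multiplies `½B(g, g)` by `s`, while replacing `g` by its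
  -- `s`-th root contributes `s⁻²`. The total is `s⁻¹`, so `u` must act through the power map of
  -- `u⁻¹`.
  SemidirectProduct.lift (shear p n a) ((powPerm p n a).comp invMonoidHom) fun u => by
    refine MonoidHom.ext fun B => ?_
    change _ = powPerm p n a u⁻¹ * shear p n a B * (powPerm p n a u⁻¹)⁻¹
    rw [eq_mul_inv_iff_mul_eq]
    refine Equiv.ext fun g => ?_
    change shear p n a (Multiplicative.ofAdd (u • Multiplicative.toAdd B)) (powPerm p n a u⁻¹ g) =
      powPerm p n a u⁻¹ (shear p n a B g)
    rw [shear_apply, shear_apply, powPerm_mul_ofW, toV_powPerm, toAdd_ofAdd, Units.smul_def,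
      Submodule.coe_smul]
    simp only [LinearMap.smul_apply, map_smul, smul_smul]
    congr 3
    rw [Units.inv_mul, mul_one, mul_comm]

/-! ### The embedding of the semidirect product into `T(G)` -/

theorem semidirectPerm_apply (x : Multiplicative (symmBilin (ZMod p) (V p n a) (W p n a))
      ⋊[scalarAction (ZMod p) (symmBilin (ZMod p) (V p n a) (W p n a))] (ZMod p)ˣ) :
    semidirectPerm p n a x = shear p n a x.left * powPerm p n a x.right⁻¹ := rfl

theorem eq_one_of_semidirectPerm_mem_Hol (h2 : (2 : ZMod p) ≠ 0) [Nontrivial (V p n a)]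
    (hZ : Subgroup.center (CarantiGroup p n a) = commutator (CarantiGroup p n a))
    (hcentral : ∀ β : MulAut (CarantiGroup p n a), IsCentralAut β)
    (x : Multiplicative (symmBilin (ZMod p) (V p n a) (W p n a))
      ⋊[scalarAction (ZMod p) (symmBilin (ZMod p) (V p n a) (W p n a))] (ZMod p)ˣ)
    (hx : semidirectPerm p n a x ∈ Hol (CarantiGroup p n a)) : x = 1 := by
  obtain ⟨L, h, hL⟩ := exists_forall_eq_of_mem_Hol hZ hcentral hx
  simp only [semidirectPerm_apply, Equiv.Perm.mul_apply] at hL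
  have h1 : h = 1 := by
    have := hL 1
    rw [powPerm_apply, one_pow, shear_apply] at this
    simpa [toV_one, ofW_zero] using this.symm
  subst h1
  simp only [mul_one] at hL
  -- Modulo `G'` the shear and `L` disappear, leaving multiplication by `u⁻¹` equal to the identity
  -- on `V ≠ 0`.
  have hu : x.right = 1 := by
    obtain ⟨v, hv⟩ := exists_ne (0 : V p n a)
    obtain ⟨g, rfl⟩ := toV_surjective v
    have := congrArg toV (hL g)
    rw [toV_shear, toV_powPerm, toV_mul, toV_ofW, add_zero] at this
    have h3 : ((x.right⁻¹ : (ZMod p)ˣ) : ZMod p) = 1 :=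
      smul_left_injective _ hv (this.trans (one_smul _ _).symm)
    rwa [Units.val_eq_one, inv_eq_one] at h3
  rw [hu, inv_one, map_one] at hL
  have hq : ∀ v, (2 : ZMod p)⁻¹ • (Multiplicative.toAdd x.left).1 v v = L v := by
    intro v
    obtain ⟨g, rfl⟩ := toV_surjective v
    have := hL g
    rw [Equiv.Perm.one_apply, shear_apply] at this
    exact ofW_injective (mul_left_cancel this)
  -- The map `½B(v, v)` equals the additive map `L`, so its polarisation `B` vanishes.
  have hB : Multiplicative.toAdd x.left = 0 := by
    refine Subtype.ext (LinearMap.ext₂ fun v w => ?_)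
    have h3 := hq (v + w)
    rw [map_add L, ← hq v, ← hq w] at h3
    simp only [map_add, LinearMap.add_apply, smul_add] at h3
    rw [(Multiplicative.toAdd x.left).2 w v] at h3
    have h4 : (2 : ZMod p)⁻¹ • (Multiplicative.toAdd x.left).1 v w +
        (2 : ZMod p)⁻¹ • (Multiplicative.toAdd x.left).1 v w = 0 := by
      rw [← sub_eq_zero] at h3
      rw [← h3]
      abel
    rwa [← add_smul, ← two_mul, mul_inv_cancel₀ h2, one_smul] at h4
  exact SemidirectProduct.ext hB hu

theorem range_semidirectPerm_le (h2 : (2 : ZMod p) ≠ 0)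
    (hZ : Subgroup.center (CarantiGroup p n a) = commutator (CarantiGroup p n a))
    (hcentral : ∀ β : MulAut (CarantiGroup p n a), IsCentralAut β) :
    (semidirectPerm p n a).range ≤ NHol (CarantiGroup p n a) :=
  range_le_NHol _ fun x f hf => by
    have := conj_mem_Hol hZ hcentral (shear_conj h2 x.left)
      (conj_mem_Hol hZ hcentral (powPerm_conj x.right⁻¹) hf)
    rw [semidirectPerm_apply]
    convert this using 1
    group

/-- The homomorphism `𝔇 ⋊ 𝔽_p^* → T(G)`. -/
def semidirectToTGroup (h : (semidirectPerm p n a).range ≤ NHol (CarantiGroup p n a)) :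
    Multiplicative (symmBilin (ZMod p) (V p n a) (W p n a))
      ⋊[scalarAction (ZMod p) (symmBilin (ZMod p) (V p n a) (W p n a))] (ZMod p)ˣ →*
      TGroup (CarantiGroup p n a) :=
  (QuotientGroup.mk' _).comp ((semidirectPerm p n a).codRestrict _ fun x => h ⟨x, rfl⟩)

theorem semidirectToTGroup_injective (h2 : (2 : ZMod p) ≠ 0) [Nontrivial (V p n a)]
    (hZ : Subgroup.center (CarantiGroup p n a) = commutator (CarantiGroup p n a))
    (hcentral : ∀ β : MulAut (CarantiGroup p n a), IsCentralAut β)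
    (h : (semidirectPerm p n a).range ≤ NHol (CarantiGroup p n a)) :
    Function.Injective (semidirectToTGroup h) := by
  refine (injective_iff_map_eq_one _).2 fun x hx => ?_
  exact eq_one_of_semidirectPerm_mem_Hol h2 hZ hcentral x
    (Subgroup.mem_subgroupOf.1 ((QuotientGroup.eq_one_iff _).1 hx))

end CarantiGroup

/-- The scalar `2` is a unit and moves every nonzero vector, as `2d = d` gives `d = 0`. -/
theorem scalarAction_semidirect_not_commutative (p : ℕ) [Fact p.Prime] (h2 : (2 : ZMod p) ≠ 0) (D : Type*)
    [AddCommGroup D] [Module (ZMod p) D] [Nontrivial D] :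
    ∃ x y : Multiplicative D ⋊[scalarAction (ZMod p) D] (ZMod p)ˣ, x * y ≠ y * x := by
  obtain ⟨d, hd⟩ := exists_ne (0 : D)
  refine ⟨SemidirectProduct.inr (Units.mk0 2 h2), SemidirectProduct.inl (Multiplicative.ofAdd d),
    fun h => hd ?_⟩
  have h3 := congrArg SemidirectProduct.left h
  rw [SemidirectProduct.mul_left, SemidirectProduct.mul_left] at h3
  have h4 : (0 : D) + (2 : ZMod p) • d = d + 0 := by
    rw [SemidirectProduct.left_inr, SemidirectProduct.right_inl, map_one,
      SemidirectProduct.left_inl] at h3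
    exact congrArg Multiplicative.toAdd h3
  rwa [zero_add, add_zero, two_smul, add_eq_left] at h4

theorem mainTheorem5 (p n : ℕ) (hp : p.Prime) (hp2 : 2 < p) (hn : 4 ≤ n)
    (a : Fin n → Fin n → Fin n → ZMod p)
    (hcard : Nat.card (CarantiGroup p n a) = p ^ (n + n.choose 2))
    (hcentral : ∀ β : MulAut (CarantiGroup p n a), IsCentralAut β) :
    Module.finrank (ZMod p) (symmBilin (ZMod p) (CarantiGroup.V p n a) (CarantiGroup.W p n a)) =
        n.choose 2 * (n + 1).choose 2 ∧
      ∃ H : Subgroup (TGroup (CarantiGroup p n a)),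
        (¬ ∀ x ∈ H, ∀ y ∈ H, x * y = y * x) ∧
        Nat.card H = (p - 1) * p ^ (n.choose 2 * (n + 1).choose 2) ∧
        Nonempty (H ≃*
          Multiplicative (symmBilin (ZMod p) (CarantiGroup.V p n a) (CarantiGroup.W p n a))
            ⋊[scalarAction (ZMod p)
              (symmBilin (ZMod p) (CarantiGroup.V p n a) (CarantiGroup.W p n a))] (ZMod p)ˣ) := by
  have : Fact p.Prime := ⟨hp⟩
  have h2 : (2 : ZMod p) ≠ 0 := by
    intro h
    exact hp2.not_ge (Nat.le_of_dvd two_pos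
      ((ZMod.natCast_eq_zero_iff 2 p).1 (by exact_mod_cast h)))
  have hfr : Module.finrank (ZMod p) (symmBilin (ZMod p) (CarantiGroup.V p n a)
      (CarantiGroup.W p n a)) = n.choose 2 * (n + 1).choose 2 := by
    rw [finrank_symmBilin p (CarantiGroup.basisV hcard), (CarantiGroup.finrank_eq hcard).2]
  have : Nontrivial (CarantiGroup.V p n a) :=
    Module.nontrivial_of_finrank_pos (R := ZMod p) (by
      rw [(CarantiGroup.finrank_eq hcard).1]; omega)
  have : Nontrivial (symmBilin (ZMod p) (CarantiGroup.V p n a) (CarantiGroup.W p n a)) :=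
    Module.nontrivial_of_finrank_pos (R := ZMod p) (by
      rw [hfr]
      exact Nat.mul_pos (Nat.choose_pos (by omega)) (Nat.choose_pos (by omega)))
  have hZ := CarantiGroup.center_eq_commutator (by omega) hcard
  have hle := CarantiGroup.range_semidirectPerm_le h2 hZ hcentral
  have hinj := CarantiGroup.semidirectToTGroup_injective h2 hZ hcentral hle
  let e := MonoidHom.ofInjective hinj
  refine ⟨hfr, (CarantiGroup.semidirectToTGroup hle).range, fun hcomm => ?_, ?_, ⟨e.symm⟩⟩
  · obtain ⟨x, y, hxy⟩ := scalarAction_semidirect_not_commutative p h2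
      (symmBilin (ZMod p) (CarantiGroup.V p n a) (CarantiGroup.W p n a))
    refine hxy (hinj ?_)
    rw [map_mul, map_mul]
    exact hcomm _ ⟨x, rfl⟩ _ ⟨y, rfl⟩
  · rw [← Nat.card_congr e.toEquiv, SemidirectProduct.card, Nat.card_eq_fintype_card (α := (ZMod p)ˣ),
      ZMod.card_units, mul_comm, Nat.card_congr Multiplicative.toAdd,
      Module.natCard_eq_pow_finrank (K := ZMod p), Nat.card_zmod, hfr]
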